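/- Setting. A (unitary) two-dimensional rational conformal model is given by its modular data: a finite set $P$ of primaries with a vacuum $0\in P$ and a charge conjugation $p\mapsto\bar p$, a central charge $c\in\mathbb{R}$, conformal weights $h_p\in\mathbb{R}$ with $h_0=0$, a symmetric unitary matrix $S=(S_{pq})$ with $S_{0p}>0$ for all $p$, such that $S^2$ is the permutation matrix of $p\mapsto\bar p$ and $(ST)^3=S^2$ for $T=\mathrm{diag}\left(e^{2\pi i(h_p-c/24)}\right)$, and fusion coefficients $N_{pq}^r\in\mathbb{Z}_{\ge 0}$ satisfying Verlinde's formula $N_{pq}^r=\sum_s S_{ps}S_{qs}\overline{S_{rs}}/S_{0s}$. The irreducible representation of the fusion algebra attached to $p$ is $\rho_p(\alpha)=S_{\alpha p}/S_{0p}$, and the quantum dimension of $p$ is $d_p=S_{0p}/S_{00}$. The deconstruction lattice $\mathscr{L}$ consists of the sets $\mathfrak{g}\subseteq P$ that contain $0$ and are closed under fusion ($p,q\in\mathfrak{g}$ and $N_{pq}^r>0$ imply $r\in\mathfrak{g}$), ordered by inclusion, with meet $\cap$ and join $\vee$. For $\mathfrak{g}\in\mathscr{L}$, primaries $p,q$ are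 in the same $\mathfrak{g}$-class if $\rho_p$ and $\rho_q$ agree on $\mathfrak{g}$; the dual $\mathfrak{g}^{\perp}\in\mathscr{L}$ is the $\mathfrak{g}$-class of $0$, and for any set $A\subseteq P$, $A^{\perp}\in\mathscr{L}$ denotes likewise the set of all $p$ such that $\rho_p=\rho_0$ on $A$. The center $Z(\mathfrak{g})$ is the set of central classes, i.e. of $\mathfrak{g}$-classes $C$ of minimal mass $\sum_{p\in C}d_p^2$; it is an abelian group, in which the product of two central classes is the one whose central character is the product of their central characters, where the central character of $\mathtt{z}$ is $\varpi_{\mathtt{z}}(\alpha)=\rho_p(\alpha)/d_\alpha$ ($p\in\mathtt{z}$, $\alpha\in\mathfrak{g}$); its identity is $\mathfrak{g}^\perp$. For $\mathfrak{h}\subseteq\mathfrak{g}$, mapping each central $\mathfrak{g}$-class to the $\mathfrak{h}$-class containing it is a homomorphism $Z(\mathfrak{g})\to Z(\mathfrak{h})$; its kernel and image are denoted by $Z(\mathfrak{g}|\mathfrak{h})$ and $I(\mathfrak{g}|\mathfrak{h})$. For a subgroup $H$ of $Z(\mathfrak{g})$ the central quotient $\mathfrak{g}/H\in\mathscr{L}$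 is $\left(\bigcup_{\mathtt{z}\in H}\mathtt{z}\right)^{\perp}$; $\boldsymbol{\partial}\mathfrak{g}=\mathfrak{g}/Z(\mathfrak{g})$ is the maximal central quotient, and $\mathfrak{g}^{\intercal}=\left(\boldsymbol{\partial}(\mathfrak{g}^{\perp})\right)^{\perp}$ the maximal central extension of $\mathfrak{g}$. Lemma. Let $\mathfrak{g},\mathfrak{h}\in\mathscr{L}$ with $\mathfrak{h}\subseteq\mathfrak{g}$ (so that $\mathfrak{g}^\perp\subseteq\mathfrak{h}^\perp$ and $\mathfrak{h}\subseteq\mathfrak{g}\cap\mathfrak{h}^{\intercal}$). Then there are isomorphisms of groups $$Z(\mathfrak{h}^{\perp}|\mathfrak{g}^{\perp})\cong Z(\mathfrak{g}\cap\mathfrak{h}^{\intercal}|\mathfrak{h})\quad\text{and}\quad I(\mathfrak{h}^{\perp}|\mathfrak{g}^{\perp})\cong Z(\mathfrak{h}^{\intercal}\vee\mathfrak{g}|\mathfrak{g}).$$ In particular, if $\mathfrak{h}=\mathfrak{g}/H$ for some subgroup $H$ of $Z(\mathfrak{g})$, i.e. if $\mathfrak{h}$ is a central quotient of $\mathfrak{g}$,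 then $\mathfrak{g}\subseteq\mathfrak{h}^{\intercal}$, and $Z(\mathfrak{h}^{\perp}|\mathfrak{g}^{\perp})\cong Z(\mathfrak{g}|\mathfrak{h})$ and $I(\mathfrak{h}^{\perp}|\mathfrak{g}^{\perp})\cong Z(\mathfrak{h}^{\intercal}|\mathfrak{g})$. -/

import Mathlib

open scoped BigOperators

/-- The modular data of a (unitary) two-dimensional rational conformal model with finite set of
primaries `P`: the vacuum, charge conjugation, the conformal weights, the central charge, the
modular matrix `S` and the fusion coefficients `N p q r` (multiplicity of `r` in the fusion product
of `p` and `q`), related by the modular relations and the formula of Verlinde. -/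
structure ConformalModel (P : Type*) [Fintype P] [DecidableEq P] where
  /-- the vacuum -/
  vac : P
  /-- charge conjugation -/
  conj : P → P
  /-- the conformal weights -/
  weight : P → ℝ
  /-- the central charge -/
  charge : ℝ
  /-- the modular `S`-matrix -/
  S : Matrix P P ℂ
  /-- the fusion rule coefficients -/
  N : P → P → P → ℕ
  weight_vac : weight vac = 0
  S_symm : ∀ p q, S p q = S q p
  S_unitary : S ∈ Matrix.unitaryGroup P ℂ
  S_sq : ∀ p q, (S * S) p q = if q = conj p then 1 else 0
  /-- the vacuum row of `S` is real and positive, i.e. all quantum dimensions are positive -/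
  S_vac_pos : ∀ p, (S vac p).im = 0 ∧ 0 < (S vac p).re
  /-- the relation `(ST)^3 = S^2`, where `T` is the diagonal matrix `exp (2πi (h_p - c/24))` -/
  modular : (S * Matrix.diagonal fun p =>
      Complex.exp (2 * Real.pi * Complex.I * ((weight p : ℂ) - (charge : ℂ) / 24))) ^ 3 = S ^ 2
  verlinde : ∀ p q r, (N p q r : ℂ) = ∑ s, S p s * S q s * star (S r s) / S vac s

namespace ConformalModel

variable {P : Type*} [Fintype P] [DecidableEq P] (M : ConformalModel P)

/-! ## The fusion algebra and its irreducible representations -/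

/-- The irreducible representation `ρ_p` of the fusion algebra attached to the primary `p`,
evaluated at the primary `a`. -/
noncomputable def rho (p a : P) : ℂ := M.S a p / M.S M.vac p

/-- The quantum dimension of a primary. -/
noncomputable def qdim (p : P) : ℝ := (M.S M.vac p).re / (M.S M.vac M.vac).re

theorem S_vac_eq (p : P) : M.S M.vac p = ((M.S M.vac p).re : ℂ) :=
  Complex.ext rfl (by simp [(M.S_vac_pos p).1])

theorem S_vac_ne (p : P) : M.S M.vac p ≠ 0 := fun h => by
  have := (M.S_vac_pos p).2
  simp [h] at this

theorem qdim_pos (p : P) : 0 < M.qdim p := div_pos (M.S_vac_pos p).2 (M.S_vac_pos _).2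

theorem qdim_eq (p : P) : (M.qdim p : ℂ) = M.S M.vac p / M.S M.vac M.vac := by
  rw [M.S_vac_eq p, M.S_vac_eq M.vac, qdim]; push_cast; simp

theorem rho_vac_left (a : P) : M.rho M.vac a = M.qdim a := by
  rw [qdim_eq, rho, M.S_symm]

theorem rho_vac_right (p : P) : M.rho p M.vac = 1 := div_self (M.S_vac_ne p)

theorem rho_symm {p a : P} {u : ℂ} (h : M.rho p a = M.qdim a * u) :
    M.rho a p = M.qdim p * u := by
  have h0 := M.S_vac_ne M.vac
  have h1 := M.S_vac_ne p
  have h2 := M.S_vac_ne a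
  rw [qdim_eq, rho] at *
  rw [M.S_symm p a]
  field_simp at h ⊢
  exact h

theorem unitary_cols (s t : P) : ∑ r, star (M.S r s) * M.S r t = if s = t then 1 else 0 := by
  have h := congrFun (congrFun (Matrix.mem_unitaryGroup_iff'.1 M.S_unitary) s) t
  simpa [Matrix.mul_apply, Matrix.one_apply, Matrix.star_apply] using h

/-- `ρ_s` is a representation of the fusion algebra. -/
theorem rho_mul (s p q : P) : M.rho s p * M.rho s q = ∑ r, (M.N p q r : ℂ) * M.rho s r := by
  have key : ∑ r, (M.N p q r : ℂ) * M.S r s = M.S p s * M.S q s / M.S M.vac s := by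
    calc ∑ r, (M.N p q r : ℂ) * M.S r s
        = ∑ r, ∑ t, M.S p t * M.S q t / M.S M.vac t * (star (M.S r t) * M.S r s) := by
          refine Finset.sum_congr rfl fun r _ => ?_
          rw [M.verlinde, Finset.sum_mul]
          exact Finset.sum_congr rfl fun t _ => by ring
      _ = ∑ t, M.S p t * M.S q t / M.S M.vac t * (if t = s then 1 else 0) := by
          rw [Finset.sum_comm]
          refine Finset.sum_congr rfl fun t _ => ?_
          rw [← Finset.mul_sum, unitary_cols]
      _ = _ := by simp
  simp only [rho]
  simp only [mul_div_assoc']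
  rw [← Finset.sum_div, key]
  have := M.S_vac_ne s
  field_simp

theorem qdim_mul (p q : P) : M.qdim p * M.qdim q = ∑ r, (M.N p q r : ℝ) * M.qdim r := by
  have h := M.rho_mul M.vac p q
  simp only [rho_vac_left] at h
  exact_mod_cast h

theorem norm_rho_le (s p : P) : ‖M.rho s p‖ ≤ M.qdim p := by
  obtain ⟨m, -, hm⟩ := Finset.exists_max_image Finset.univ
    (fun q => ‖M.rho s q‖ / M.qdim q) ⟨M.vac, Finset.mem_univ _⟩
  have hm' : ∀ q, ‖M.rho s q‖ ≤ ‖M.rho s m‖ / M.qdim m * M.qdim q := fun q =>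
    (div_le_iff₀ (M.qdim_pos q)).1 (hm q (Finset.mem_univ _))
  have hpos : 0 < ‖M.rho s m‖ := by
    by_contra hcon
    have h0 : ‖M.rho s m‖ = 0 := le_antisymm (not_lt.1 hcon) (norm_nonneg _)
    have := hm' M.vac
    rw [rho_vac_right, h0] at this
    norm_num at this
  have h1 : ‖M.rho s p‖ * ‖M.rho s m‖ ≤ M.qdim p * ‖M.rho s m‖ := by
    calc ‖M.rho s p‖ * ‖M.rho s m‖ = ‖∑ r, (M.N p m r : ℂ) * M.rho s r‖ := by
          rw [← rho_mul, norm_mul]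
      _ ≤ ∑ r, (M.N p m r : ℝ) * ‖M.rho s r‖ := by
          refine (norm_sum_le _ _).trans (le_of_eq (Finset.sum_congr rfl fun r _ => ?_))
          simp
      _ ≤ ∑ r, (M.N p m r : ℝ) * (‖M.rho s m‖ / M.qdim m * M.qdim r) :=
          Finset.sum_le_sum fun r _ => mul_le_mul_of_nonneg_left (hm' r) (Nat.cast_nonneg _)
      _ = ‖M.rho s m‖ / M.qdim m * (M.qdim p * M.qdim m) := by
          rw [qdim_mul, Finset.mul_sum]
          exact Finset.sum_congr rfl fun r _ => by ring
      _ = M.qdim p * ‖M.rho s m‖ := by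
          have := (M.qdim_pos m).ne'
          field_simp
  exact le_of_mul_le_mul_right h1 hpos

/-- The case of equality in the triangle inequality for a fusion product. -/
theorem rho_fusion {s p q r : P} {u v : ℂ} (hu : ‖u‖ = 1) (hv : ‖v‖ = 1)
    (hp : M.rho s p = M.qdim p * u) (hq : M.rho s q = M.qdim q * v) (hr : 0 < M.N p q r) :
    M.rho s r = M.qdim r * (u * v) := by
  have huv : ‖u * v‖ = 1 := by rw [norm_mul, hu, hv, one_mul]
  have hss : star (u * v) * (u * v) = 1 := by
    have := Complex.conj_mul' (u * v)
    rw [huv] at this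
    simpa using this
  have hle : ∀ t, (star (u * v) * M.rho s t).re ≤ M.qdim t := fun t =>
    (Complex.re_le_norm _).trans (by
      rw [norm_mul, norm_star, huv, one_mul]; exact M.norm_rho_le s t)
  have hsum : ∑ t, (M.N p q t : ℝ) * (star (u * v) * M.rho s t).re
      = ∑ t, (M.N p q t : ℝ) * M.qdim t := by
    have h1 : star (u * v) * (M.rho s p * M.rho s q) = ((M.qdim p * M.qdim q : ℝ) : ℂ) := by
      rw [hp, hq]
      push_cast
      linear_combination ((M.qdim p : ℂ) * M.qdim q) * hss
    rw [rho_mul, qdim_mul, Finset.mul_sum] at h1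
    have h2 := congrArg Complex.re h1
    rw [Complex.ofReal_re, Complex.re_sum] at h2
    rw [← h2]
    refine Finset.sum_congr rfl fun t _ => ?_
    rw [mul_left_comm, ← Complex.ofReal_natCast, Complex.re_ofReal_mul]
  have heq := (Finset.sum_eq_sum_iff_of_le fun t _ =>
    mul_le_mul_of_nonneg_left (hle t) (Nat.cast_nonneg (M.N p q t))).1 hsum r (Finset.mem_univ _)
  have hre : (star (u * v) * M.rho s r).re = M.qdim r :=
    mul_left_cancel₀ (by exact_mod_cast hr.ne') heq
  have hnorm : ‖star (u * v) * M.rho s r‖ ≤ (star (u * v) * M.rho s r).re := by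
    rw [hre, norm_mul, norm_star, huv, one_mul]; exact M.norm_rho_le s r
  have him : star (u * v) * M.rho s r = M.qdim r := by
    have h3 := Complex.abs_re_eq_norm.1 
      (le_antisymm (Complex.abs_re_le_norm (star (u * v) * M.rho s r))
        (hnorm.trans (le_abs_self _)))
    exact Complex.ext (by simpa using hre) (by simpa using h3)
  calc M.rho s r = (star (u * v) * (u * v)) * M.rho s r := by rw [hss, one_mul]
    _ = (star (u * v) * M.rho s r) * (u * v) := by ring
    _ = _ := by rw [him]

theorem exists_fusion (p q : P) : ∃ r, 0 < M.N p q r := by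
  by_contra! h
  have h1 := M.qdim_mul p q
  rw [Finset.sum_eq_zero fun r _ => by simp [Nat.le_zero.1 (h r)]] at h1
  exact (mul_pos (M.qdim_pos p) (M.qdim_pos q)).ne' h1

theorem S_conj (a p : P) : M.S a (M.conj p) = star (M.S a p) := by
  have hU : M.S * star M.S = 1 := Matrix.mem_unitaryGroup_iff.1 M.S_unitary
  have h : (M.S * M.S) * star M.S = M.S := by rw [Matrix.mul_assoc, hU, Matrix.mul_one]
  have h1 := congrFun (congrFun h p) a
  rw [Matrix.mul_apply] at h1
  simp only [M.S_sq, Matrix.star_apply, ite_mul, one_mul, zero_mul, Finset.sum_ite_eq',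
    Finset.mem_univ, if_true] at h1
  rw [M.S_symm a p, ← h1, star_star]

theorem rho_conj (p a : P) : M.rho (M.conj p) a = star (M.rho p a) := by
  rw [rho, rho, S_conj, S_conj, star_div₀]

theorem rho_conj_right (p a : P) : M.rho p (M.conj a) = star (M.rho p a) := by
  have h0 : star (M.S M.vac p) = M.S M.vac p := by
    rw [M.S_vac_eq p]; exact Complex.conj_ofReal _
  rw [rho, rho, M.S_symm, S_conj, M.S_symm p a, star_div₀, h0]

theorem qdim_conj (p : P) : M.qdim (M.conj p) = M.qdim p := by
  rw [qdim, qdim, S_conj]; simp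

theorem N_conj (b a c : P) : M.N b a c = M.N (M.conj b) c a := by
  have h : (M.N b a c : ℂ) = (M.N (M.conj b) c a : ℂ) := by
    have h1 : star (M.N b a c : ℂ) = (M.N b a c : ℂ) := Complex.conj_natCast _
    rw [← h1, M.verlinde, M.verlinde, star_sum]
    refine Finset.sum_congr rfl fun s _ => ?_
    have h0 : star (M.S M.vac s) = M.S M.vac s := by
      rw [M.S_vac_eq s]; exact Complex.conj_ofReal _
    rw [star_div₀, star_mul', star_mul', star_star, h0, M.S_symm (M.conj b) s, S_conj,
      M.S_symm s b]
    ring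
  exact_mod_cast h

/-! ## The deconstruction lattice -/

/-- The elements of the deconstruction lattice: sets of primaries that contain the vacuum and are
closed under the fusion product. -/
@[ext] structure FC where
  carrier : Set P
  vac_mem : M.vac ∈ carrier
  fusion_mem : ∀ {p q r}, p ∈ carrier → q ∈ carrier → 0 < M.N p q r → r ∈ carrier

namespace FC

variable {M}

instance : SetLike M.FC P where
  coe := FC.carrier
  coe_injective _ _ h := FC.ext h

/-- The order is set inclusion. -/
instance : PartialOrder M.FC := PartialOrder.ofSetLike M.FC P

instance : Min M.FC where
  min g h := ⟨(g : Set P) ∩ h, ⟨g.vac_mem, h.vac_mem⟩, fun hp hq hr =>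
    ⟨g.fusion_mem hp.1 hq.1 hr, h.fusion_mem hp.2 hq.2 hr⟩⟩

instance : InfSet M.FC where
  sInf A := ⟨⋂ k ∈ A, (k : Set P), Set.mem_iInter₂.2 fun k _ => k.vac_mem, fun hp hq hr =>
    Set.mem_iInter₂.2 fun k hk =>
      k.fusion_mem (Set.mem_iInter₂.1 hp k hk) (Set.mem_iInter₂.1 hq k hk) hr⟩

/-- The meet is set intersection, the join of `g` and `h` is the smallest fusion closed set that
contains both `g` and `h`. -/
instance : Lattice M.FC where
  inf g h := min g h
  inf_le_left _ _ := Set.inter_subset_left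
  inf_le_right _ _ := Set.inter_subset_right
  le_inf _ _ _ h₁ h₂ := Set.subset_inter h₁ h₂
  sup g h := sInf {k | g ≤ k ∧ h ≤ k}
  le_sup_left _ _ := Set.subset_iInter₂ fun _ hk => hk.1
  le_sup_right _ _ := Set.subset_iInter₂ fun _ hk => hk.2
  sup_le _ _ _ h₁ h₂ := Set.biInter_subset_of_mem ⟨h₁, h₂⟩

end FC

/-! ## Classes, duality, mass and central classes -/

/-- The class of `p` with respect to a set `A` of primaries: all primaries `q` such that `ρ_q` and
`ρ_p` coincide on `A`. -/
def cls (A : Set P) (p : P) : Set P := {q | ∀ a ∈ A, M.rho q a = M.rho p a}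

theorem mem_cls_self (A : Set P) (p : P) : p ∈ M.cls A p := fun _ _ => rfl

theorem cls_eq {A : Set P} {p q : P} (h : q ∈ M.cls A p) : M.cls A q = M.cls A p := by
  ext r
  exact ⟨fun hr a ha => (hr a ha).trans (h a ha), fun hr a ha => (hr a ha).trans (h a ha).symm⟩

/-- The trivial class `A^⊥`, i.e. the class of the vacuum; it is an element of the lattice. -/
def perp (A : Set P) : M.FC where
  carrier := M.cls A M.vac
  vac_mem := M.mem_cls_self A M.vac
  fusion_mem {p q r} hp hq hr := fun a ha => by
    have hp' := M.rho_symm (u := 1) (by rw [hp a ha, rho_vac_left, mul_one])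
    have hq' := M.rho_symm (u := 1) (by rw [hq a ha, rho_vac_left, mul_one])
    have h := M.rho_symm (M.rho_fusion (by simp) (by simp) hp' hq' hr)
    rw [h, rho_vac_left]; simp

open Classical in
/-- The mass of a set of primaries. -/
noncomputable def mass (C : Set P) : ℝ := ∑ p with p ∈ C, M.qdim p ^ 2

/-- `C` is a central class of `g`: a `g`-class whose mass is minimal among all `g`-classes. -/
def IsCentral (g : M.FC) (C : Set P) : Prop :=
  (∃ p, C = M.cls g p) ∧ ∀ q, M.mass C ≤ M.mass (M.cls g q)

section mass

variable {M}

theorem FC.mem_of_fusion (g : M.FC) {a b c : P} (hb : b ∈ g) (hc : c ∈ g) (h : 0 < M.N b a c) :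
    a ∈ g := by
  classical
  by_contra ha
  have h1 : ∑ a with a ∈ g, M.qdim a * ∑ c, (M.N b a c : ℝ) * M.qdim c
      = ∑ a with a ∈ g, M.qdim a * ∑ c with c ∈ g, (M.N b a c : ℝ) * M.qdim c := by
    refine Finset.sum_congr rfl fun a ha => ?_
    congr 1
    symm
    refine Finset.sum_subset (Finset.subset_univ _) fun c _ hc => ?_
    have : M.N b a c = 0 := by
      by_contra hne
      exact hc (Finset.mem_filter.2 ⟨Finset.mem_univ _,
        g.fusion_mem hb (Finset.mem_filter.1 ha).2 (Nat.pos_of_ne_zero hne)⟩)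
    simp [this]
  have h2 : ∑ c with c ∈ g, M.qdim c * ∑ a, (M.N b a c : ℝ) * M.qdim a
      = M.qdim b * ∑ c with c ∈ g, M.qdim c ^ 2 := by
    rw [Finset.mul_sum]
    refine Finset.sum_congr rfl fun c _ => ?_
    simp only [M.N_conj b _ c]
    rw [← qdim_mul, qdim_conj]; ring
  have h3 : ∑ a with a ∈ g, M.qdim a * ∑ c, (M.N b a c : ℝ) * M.qdim c
      = M.qdim b * ∑ c with c ∈ g, M.qdim c ^ 2 := by
    rw [Finset.mul_sum]
    refine Finset.sum_congr rfl fun c _ => ?_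
    rw [← qdim_mul]; ring
  have h4 : ∑ a with a ∈ g, M.qdim a * ∑ c with c ∈ g, (M.N b a c : ℝ) * M.qdim c
      = ∑ c with c ∈ g, M.qdim c * ∑ a with a ∈ g, (M.N b a c : ℝ) * M.qdim a := by
    simp only [Finset.mul_sum]
    rw [Finset.sum_comm]
    exact Finset.sum_congr rfl fun _ _ => Finset.sum_congr rfl fun _ _ => by ring
  have h5 : ∑ c with c ∈ g, M.qdim c * ∑ a with a ∈ g, (M.N b a c : ℝ) * M.qdim a
      < ∑ c with c ∈ g, M.qdim c * ∑ a, (M.N b a c : ℝ) * M.qdim a := by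
    have hnn : ∀ a c, 0 ≤ (M.N b a c : ℝ) * M.qdim a := fun a c =>
      mul_nonneg (Nat.cast_nonneg _) (M.qdim_pos a).le
    refine Finset.sum_lt_sum (fun c _ => mul_le_mul_of_nonneg_left
      (Finset.sum_le_sum_of_subset_of_nonneg (Finset.subset_univ _) fun a _ _ => hnn a c)
      (M.qdim_pos c).le) ⟨c, by simpa using hc, mul_lt_mul_of_pos_left ?_ (M.qdim_pos c)⟩
    refine Finset.sum_lt_sum_of_subset (Finset.subset_univ _) (Finset.mem_univ a)
      (by simpa using ha) (mul_pos (by exact_mod_cast h) (M.qdim_pos a)) fun a _ _ => hnn a c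
  linarith

theorem rho_orthogonal (g : M.FC) [DecidablePred (· ∈ g)] {p q b : P} (hb : b ∈ g) :
    (M.rho q b - M.rho p b) * ∑ a with a ∈ g, star (M.rho p a) * M.rho q a = 0 := by
  rw [sub_mul, sub_eq_zero]
  have hl : M.rho q b * ∑ a with a ∈ g, star (M.rho p a) * M.rho q a
      = ∑ a with a ∈ g, ∑ c with c ∈ g, (M.N b a c : ℂ) * (star (M.rho p a) * M.rho q c) := by
    rw [Finset.mul_sum]
    refine Finset.sum_congr rfl fun a ha => ?_
    rw [mul_left_comm, rho_mul, Finset.mul_sum]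
    symm
    refine (Finset.sum_subset (Finset.subset_univ _) fun c _ hc => ?_).trans
      (Finset.sum_congr rfl fun c _ => by ring)
    have : M.N b a c = 0 := by
      by_contra hne
      exact hc (Finset.mem_filter.2 ⟨Finset.mem_univ _,
        g.fusion_mem hb (Finset.mem_filter.1 ha).2 (Nat.pos_of_ne_zero hne)⟩)
    simp [this]
  have hr : M.rho p b * ∑ c with c ∈ g, star (M.rho p c) * M.rho q c
      = ∑ c with c ∈ g, ∑ a with a ∈ g, (M.N b a c : ℂ) * (star (M.rho p a) * M.rho q c) := by
    rw [Finset.mul_sum]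
    refine Finset.sum_congr rfl fun c hc => ?_
    have h1 : M.rho p b * star (M.rho p c) = ∑ a, (M.N b a c : ℂ) * star (M.rho p a) := by
      have h2 := congrArg star (M.rho_mul p (M.conj b) c)
      rw [star_mul', rho_conj_right, star_star, star_sum] at h2
      rw [h2]
      refine Finset.sum_congr rfl fun a _ => ?_
      rw [M.N_conj b a c, star_mul']
      congr 1
      exact Complex.conj_natCast _
    rw [← mul_assoc, h1, Finset.sum_mul]
    symm
    refine (Finset.sum_subset (Finset.subset_univ _) fun a _ ha => ?_).trans
      (Finset.sum_congr rfl fun a _ => by ring)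
    have : M.N b a c = 0 := by
      by_contra hne
      exact ha (Finset.mem_filter.2 ⟨Finset.mem_univ _,
        g.mem_of_fusion hb (Finset.mem_filter.1 hc).2 (Nat.pos_of_ne_zero hne)⟩)
    simp [this]
  rw [hl, hr, Finset.sum_comm]

theorem mass_mul (g : M.FC) [DecidablePred (· ∈ g)] (p : P) :
    M.mass (M.cls g p) * ∑ a with a ∈ g, ‖M.rho p a‖ ^ 2 = 1 / (M.S M.vac M.vac).re ^ 2 := by
  classical
  set K : P → ℂ := fun q => ∑ a with a ∈ g, star (M.rho p a) * M.rho q a with hK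
  have hKp : ∀ q ∈ M.cls g p, K q = ((∑ a with a ∈ g, ‖M.rho p a‖ ^ 2 : ℝ) : ℂ) := by
    intro q hq
    push_cast
    refine Finset.sum_congr rfl fun a ha => ?_
    rw [hq a (Finset.mem_filter.1 ha).2]
    exact Complex.conj_mul' _
  have hK0 : ∀ q, q ∉ M.cls g p → K q = 0 := by
    intro q hq
    simp only [cls, Set.mem_ofPred_eq, not_forall] at hq
    obtain ⟨b, hb, hne⟩ := hq
    exact (mul_eq_zero.1 (rho_orthogonal g (p := p) (q := q) hb)).resolve_left
      (sub_ne_zero.2 hne)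
  have hrows : ∀ a, ∑ q, M.S M.vac q * M.S a q = if M.vac = a then 1 else 0 := by
    intro a
    rw [← M.unitary_cols]
    refine Finset.sum_congr rfl fun q _ => ?_
    rw [M.S_symm q M.vac, M.S_symm q a]
    congr 1
    rw [M.S_vac_eq q]; exact (Complex.conj_ofReal _).symm
  have htot : ∑ q, M.S M.vac q ^ 2 * K q = 1 := by
    have h1 : ∀ q, M.S M.vac q ^ 2 * K q
        = ∑ a with a ∈ g, star (M.rho p a) * (M.S M.vac q * M.S a q) := by
      intro q
      rw [hK, Finset.mul_sum]
      refine Finset.sum_congr rfl fun a _ => ?_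
      have := M.S_vac_ne q
      rw [rho, rho]; field_simp
    simp only [h1]
    rw [Finset.sum_comm]
    simp only [← Finset.mul_sum, hrows]
    have hv : M.vac ∈ g := g.vac_mem
    simp [hv, rho_vac_right]
  have h2 : ∑ q, M.S M.vac q ^ 2 * K q
      = ∑ q with q ∈ M.cls g p,
        M.S M.vac q ^ 2 * ((∑ a with a ∈ g, ‖M.rho p a‖ ^ 2 : ℝ) : ℂ) := by
    rw [Finset.sum_filter]
    refine Finset.sum_congr rfl fun q _ => ?_
    split_ifs with hq
    · rw [hKp q hq]
    · rw [hK0 q hq, mul_zero]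
  rw [htot, ← Finset.sum_mul] at h2
  have h3 : (1 : ℝ) = (∑ q with q ∈ M.cls g p, (M.S M.vac q).re ^ 2)
      * ∑ a with a ∈ g, ‖M.rho p a‖ ^ 2 := by
    have h4 : ∑ q with q ∈ M.cls g p, M.S M.vac q ^ 2
        = ((∑ q with q ∈ M.cls g p, (M.S M.vac q).re ^ 2 : ℝ) : ℂ) := by
      push_cast
      exact Finset.sum_congr rfl fun q _ => by rw [← M.S_vac_eq q]
    rw [h4] at h2
    exact_mod_cast h2
  have h5 : M.mass (M.cls g p)
      = (∑ q with q ∈ M.cls g p, (M.S M.vac q).re ^ 2) / (M.S M.vac M.vac).re ^ 2 := by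
    rw [mass, Finset.sum_div]
    exact Finset.sum_congr (by ext; simp) fun q _ => by rw [qdim, div_pow]
  rw [h5, h3]
  ring

/-- The class of `p` is central iff `ρ_p(a)` has the largest possible modulus for all `a` in `g`. -/
theorem isCentral_iff (g : M.FC) (p : P) :
    M.IsCentral g (M.cls g p) ↔ ∀ a ∈ g, ‖M.rho p a‖ = M.qdim a := by
  classical
  have hS : 0 < 1 / (M.S M.vac M.vac).re ^ 2 := by
    have := (M.S_vac_pos M.vac).2
    positivity
  have hQ : ∀ q, 0 < ∑ a with a ∈ g, ‖M.rho q a‖ ^ 2 := fun q => by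
    refine Finset.sum_pos' (fun a _ => by positivity)
      ⟨M.vac, Finset.mem_filter.2 ⟨Finset.mem_univ _, g.vac_mem⟩, ?_⟩
    rw [rho_vac_right]; norm_num
  have hm : ∀ q, M.mass (M.cls g q)
      = 1 / (M.S M.vac M.vac).re ^ 2 / ∑ a with a ∈ g, ‖M.rho q a‖ ^ 2 := fun q =>
    eq_div_of_mul_eq (hQ q).ne' (mass_mul g q)
  have hsq : ∀ q a, ‖M.rho q a‖ ^ 2 ≤ M.qdim a ^ 2 := fun q a =>
    pow_le_pow_left₀ (norm_nonneg _) (M.norm_rho_le q a) 2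
  constructor
  · rintro ⟨-, hmin⟩ a ha
    have h1 := hmin M.vac
    rw [hm, hm, div_le_div_iff_of_pos_left hS (hQ _) (hQ _)] at h1
    have h2 : ∀ a, ‖M.rho M.vac a‖ ^ 2 = M.qdim a ^ 2 := fun a => by
      rw [rho_vac_left, Complex.norm_real, Real.norm_eq_abs, sq_abs]
    simp only [h2] at h1
    have h3 := (Finset.sum_eq_sum_iff_of_le fun a _ => hsq p a).1
      (le_antisymm (Finset.sum_le_sum fun a _ => hsq p a) h1) a
      (Finset.mem_filter.2 ⟨Finset.mem_univ _, ha⟩)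
    exact (pow_left_inj₀ (norm_nonneg _) (M.qdim_pos a).le two_ne_zero).1 h3
  · refine fun h => ⟨⟨p, rfl⟩, fun q => ?_⟩
    rw [hm, hm, div_le_div_iff_of_pos_left hS (hQ _) (hQ _)]
    refine Finset.sum_le_sum fun a ha => ?_
    rw [h a (Finset.mem_filter.1 ha).2]
    exact hsq q a

end mass

/-! ## The center -/

/-- The center `Z(g)`: the set of central classes. -/
def Center (g : M.FC) : Type _ := {C : Set P // M.IsCentral g C}

namespace Center

variable {M} {g h : M.FC}

/-- The set of primaries that belong to a central class. -/
def carrier (z : M.Center g) : Set P := z.1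

/-- A chosen element of a central class. -/
noncomputable def rep (z : M.Center g) : P := z.2.1.choose

theorem carrier_eq (z : M.Center g) : z.carrier = M.cls g z.rep := z.2.1.choose_spec

theorem rep_mem (z : M.Center g) : z.rep ∈ z.carrier := by
  rw [carrier_eq]; exact M.mem_cls_self _ _

/-- The central character of a central class `z`: `ϖ_z(a) = ρ_p(a) / d_a`, where `p ∈ z`. -/
noncomputable def char (z : M.Center g) (a : P) : ℂ := M.rho z.rep a / M.qdim a

theorem rho_rep (z : M.Center g) (a : P) : M.rho z.rep a = M.qdim a * z.char a := by
  have : (M.qdim a : ℂ) ≠ 0 := by exact_mod_cast (M.qdim_pos a).ne'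
  rw [char]; field_simp

theorem rho_eq {z : M.Center g} {p : P} (hp : p ∈ z.carrier) {a : P} (ha : a ∈ g) :
    M.rho p a = M.qdim a * z.char a := by
  rw [carrier_eq] at hp
  rw [hp a ha, rho_rep]

theorem norm_char (z : M.Center g) {a : P} (ha : a ∈ g) : ‖z.char a‖ = 1 := by
  have h1 : M.IsCentral g (M.cls g z.rep) := by
    rw [← carrier_eq]; exact z.2
  rw [char, norm_div, (isCentral_iff g _).1 h1 a ha, Complex.norm_real, Real.norm_eq_abs,
    abs_of_pos (M.qdim_pos a), div_self (M.qdim_pos a).ne']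

/-- A central class is determined by its central character. -/
theorem char_ext {z w : M.Center g} (H : ∀ a ∈ g, z.char a = w.char a) : z = w := by
  refine Subtype.ext ?_
  change z.carrier = w.carrier
  rw [z.carrier_eq, w.carrier_eq]
  exact M.cls_eq fun a ha => by rw [rho_rep, rho_rep, H a ha]

/-- The central class of a primary `p` with given `ρ_p(a) = d_a ϖ(a)` and `|ϖ(a)| = 1` on `g`. -/
def ofRho (g : M.FC) (p : P) (H : ∀ a ∈ g, ‖M.rho p a‖ = M.qdim a) : M.Center g :=
  ⟨M.cls g p, (isCentral_iff g p).2 H⟩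

theorem mem_ofRho (p : P) (H : ∀ a ∈ g, ‖M.rho p a‖ = M.qdim a) :
    p ∈ (ofRho g p H).carrier := M.mem_cls_self _ _

theorem char_ofRho (p : P) (H : ∀ a ∈ g, ‖M.rho p a‖ = M.qdim a) {a : P} (ha : a ∈ g) {u : ℂ}
    (hu : M.rho p a = M.qdim a * u) : (ofRho g p H).char a = u := by
  have h0 : (M.qdim a : ℂ) ≠ 0 := by exact_mod_cast (M.qdim_pos a).ne'
  exact mul_left_cancel₀ h0 ((rho_eq (mem_ofRho p H) ha).symm.trans hu)

theorem rho_fusion {z w : M.Center g} {p q r : P} (hp : p ∈ z.carrier) (hq : q ∈ w.carrier)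
    (hr : 0 < M.N p q r) {a : P} (ha : a ∈ g) :
    M.rho r a = M.qdim a * (z.char a * w.char a) :=
  M.rho_symm (M.rho_fusion (z.norm_char ha) (w.norm_char ha) (M.rho_symm (rho_eq hp ha))
    (M.rho_symm (rho_eq hq ha)) hr)

theorem exists_mul (z w : M.Center g) :
    ∃ x : M.Center g, ∀ a ∈ g, x.char a = z.char a * w.char a := by
  obtain ⟨r, hr⟩ := M.exists_fusion z.rep w.rep
  have h := fun a (ha : a ∈ g) => rho_fusion z.rep_mem w.rep_mem hr ha
  refine ⟨ofRho g r fun a ha => ?_, fun a ha => char_ofRho _ _ ha (h a ha)⟩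
  rw [h a ha, norm_mul, norm_mul, z.norm_char ha, w.norm_char ha, Complex.norm_real,
    Real.norm_eq_abs, abs_of_pos (M.qdim_pos a), mul_one, mul_one]

theorem exists_inv (z : M.Center g) :
    ∃ x : M.Center g, ∀ a ∈ g, x.char a = (z.char a)⁻¹ := by
  have h : ∀ a ∈ g, M.rho (M.conj z.rep) a = M.qdim a * (z.char a)⁻¹ := fun a ha => by
    have h1 : (z.char a)⁻¹ = star (z.char a) := Complex.inv_eq_conj (z.norm_char ha)
    rw [rho_conj, rho_rep, star_mul', h1]
    congr 1
    exact Complex.conj_ofReal _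
  refine ⟨ofRho g (M.conj z.rep) fun a ha => ?_, fun a ha => char_ofRho _ _ ha (h a ha)⟩
  rw [h a ha, norm_mul, norm_inv, z.norm_char ha, Complex.norm_real,
    Real.norm_eq_abs, abs_of_pos (M.qdim_pos a), inv_one, mul_one]

theorem norm_rho_vac (g : M.FC) : ∀ a ∈ g, ‖M.rho M.vac a‖ = M.qdim a := fun a _ => by
  rw [rho_vac_left, Complex.norm_real, Real.norm_eq_abs, abs_of_pos (M.qdim_pos a)]

/-- The product of two central classes is the class whose central character is the product of
the central characters. -/
noncomputable instance : Mul (M.Center g) := ⟨fun z w => (exists_mul z w).choose⟩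

noncomputable instance : Inv (M.Center g) := ⟨fun z => (exists_inv z).choose⟩

/-- The identity element is the trivial class. -/
noncomputable instance : One (M.Center g) := ⟨ofRho g M.vac (norm_rho_vac g)⟩

theorem char_mul (z w : M.Center g) {a : P} (ha : a ∈ g) :
    (z * w).char a = z.char a * w.char a := (exists_mul z w).choose_spec a ha

theorem char_inv (z : M.Center g) {a : P} (ha : a ∈ g) :
    (z⁻¹).char a = (z.char a)⁻¹ := (exists_inv z).choose_spec a ha

theorem char_one {a : P} (ha : a ∈ g) : (1 : M.Center g).char a = 1 :=
  char_ofRho _ _ ha (by rw [rho_vac_left, mul_one])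

/-- The product of central classes contains the fusion products of their elements. -/
theorem fusion_mem_mul {z w : M.Center g} {p q r : P} (hp : p ∈ z.carrier) (hq : q ∈ w.carrier)
    (hr : 0 < M.N p q r) : r ∈ (z * w).carrier := by
  rw [carrier_eq]
  intro a ha
  rw [rho_rep, char_mul z w ha, rho_fusion hp hq hr ha]

/-- The center is an abelian group. -/
noncomputable instance : CommGroup (M.Center g) :=
  { Group.ofLeftAxioms (G := M.Center g)
      (fun x y z => char_ext fun a ha => by simp only [char_mul _ _ ha, mul_assoc])
      (fun x => char_ext fun a ha => by rw [char_mul _ _ ha, char_one ha, one_mul])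
      (fun x => char_ext fun a ha => by
        rw [char_mul _ _ ha, char_one ha, char_inv _ ha, inv_mul_cancel₀]
        intro h0
        have := x.norm_char ha
        rw [h0] at this
        simp at this) with
    mul_comm := fun x y => char_ext fun a ha => by
      rw [char_mul _ _ ha, char_mul _ _ ha, mul_comm] }

theorem carrier_one : (1 : M.Center g).carrier = (M.perp g : Set P) := rfl

end Center

/-! ## The restriction homomorphism -/

section restriction

variable {M} {g h : M.FC}

/-- For `h ⊆ g`, the restriction homomorphism `Z(g) → Z(h)`, which maps a central `g`-class to the
`h`-class that contains it. -/
noncomputable def res (hg : h ≤ g) : M.Center g →* M.Center h :=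
  have H : ∀ z : M.Center g, ∀ a ∈ h, ‖M.rho z.rep a‖ = M.qdim a := fun z a ha => by
    rw [z.rho_rep, norm_mul, z.norm_char (hg ha), Complex.norm_real, Real.norm_eq_abs,
      abs_of_pos (M.qdim_pos a), mul_one]
  have hc : ∀ z : M.Center g, ∀ a ∈ h,
      (Center.ofRho h z.rep (H z)).char a = z.char a := fun z a ha =>
    Center.char_ofRho _ _ ha (z.rho_rep a)
  { toFun := fun z => Center.ofRho h z.rep (H z)
    map_one' := Center.char_ext fun a ha => by
      rw [hc _ _ ha, Center.char_one (hg ha), Center.char_one ha]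
    map_mul' := fun z w => Center.char_ext fun a ha => by
      rw [hc _ _ ha, Center.char_mul _ _ (hg ha), Center.char_mul _ _ ha, hc _ _ ha, hc _ _ ha] }

theorem subset_res (hg : h ≤ g) (z : M.Center g) : z.carrier ⊆ (res hg z).carrier := by
  rw [z.carrier_eq]
  exact fun q hq a ha => hq a (hg ha)

/-- `Z(g|h)`, the kernel of the restriction homomorphism `Z(g) → Z(h)`. -/
noncomputable def ZR (M : ConformalModel P) (g h : M.FC) (hg : h ≤ g) : Subgroup (M.Center g) := (res hg).ker

/-- `I(g|h)`, the image of the restriction homomorphism `Z(g) → Z(h)`. -/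
noncomputable def IR (M : ConformalModel P) (g h : M.FC) (hg : h ≤ g) : Subgroup (M.Center h) := (res hg).range

/-- `Z(g|h)` consists of those central `g`-classes that are contained in `h^⊥`. -/
theorem mem_ZR_iff (hg : h ≤ g) (z : M.Center g) :
    z ∈ M.ZR g h hg ↔ z.carrier ⊆ (M.perp h : Set P) := by
  rw [ZR, MonoidHom.mem_ker]
  constructor
  · intro hz
    have := subset_res hg z
    rwa [hz, Center.carrier_one] at this
  · intro hz
    refine Subtype.ext ?_
    exact M.cls_eq (hz z.rep_mem)

end restriction

/-! ## Central quotients and extensions -/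

namespace FC

variable {M}

/-- The central quotient `g/H` for a subgroup `H` of `Z(g)`: the dual of the union of all central
classes that belong to `H`. -/
def quot (g : M.FC) (H : Subgroup (M.Center g)) : M.FC := M.perp (⋃ z ∈ H, z.carrier)

/-- The maximal central quotient `∂g = g/Z(g)`. -/
noncomputable def mzq (g : M.FC) : M.FC := g.quot ⊤

/-- The maximal central extension `g^⊺ = (∂(g^⊥))^⊥`. -/
noncomputable def cov (g : M.FC) : M.FC := M.perp (M.perp g).mzq

theorem perp_anti {g h : M.FC} (hg : h ≤ g) : M.perp g ≤ M.perp h :=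
  fun _ hq a ha => hq a (hg ha)

theorem subset_perp_perp (A : Set P) : A ⊆ M.perp (M.perp A : Set P) := fun a ha p hp => by
  have h1 := M.rho_symm (u := 1) (by rw [hp a ha, rho_vac_left, mul_one])
  rw [h1, rho_vac_left, mul_one]

theorem le_cov (g : M.FC) : g ≤ g.cov := fun _ hp =>
  subset_perp_perp _ (Set.mem_biUnion (Subgroup.one_mem _)
    (subset_perp_perp (g : Set P) hp : _ ∈ (1 : M.Center (M.perp g)).carrier))

end FC

end ConformalModel

/-! Two finite abelian groups are isomorphic as soon as they are paired nondegenerately into `ℂˣ`.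
Here the pairing comes from the symmetry of `S`: if `ρ_p(a) = d_a u` then `ρ_a(p) = d_p u`, so the
phase of a primary in one central class at a primary in another can be read from either side
(`Center.char_symm`).

Two facts turn this into a duality of centers. Double duality `g^⊥⊥ = g` (`perp_perp`) follows by
comparing masses. And `h^⊺` is exactly the union of the central `h^⊥`-classes (`mem_cov_iff`),
because the primaries at which a given `ρ_p` has maximal modulus form an element of the lattice.

For the first isomorphism, put `k = g ∩ h^⊺`: the central `h^⊥`-classes inside `g` cover `k`, and
the central `k`-classes inside `h^⊥` cover `h^⊥`. A central class that pairs trivially with the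
other side thus has trivial character. For the second, put `k = h^⊺ ∨ g`: a class of `Z(k|g)` has
trivial character on `g`, and pairing trivially with the image makes it trivial on `h^⊺`, hence on
the join. For a central quotient `g ⊆ h^⊺`, so the meet and the join collapse. -/

/-- Two finite abelian groups with a nondegenerate pairing into `ℂˣ` are isomorphic. -/
theorem nonempty_mulEquiv_of_nondegenerate_pairing {A B : Type*} [CommGroup A] [CommGroup B]
    [Finite A] [Finite B] (f : A →* B →* ℂˣ) (hA : ∀ a, (∀ b, f a b = 1) → a = 1)
    (hB : ∀ b, (∀ a, f a b = 1) → b = 1) : Nonempty (A ≃* B) := by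
  -- Each group is (noncanonically) isomorphic to its dual, so the two embeddings into duals given
  -- by the pairing become embeddings of `A` in `B` and of `B` in `A`.
  obtain ⟨eA⟩ := CommGroup.monoidHom_mulEquiv_of_hasEnoughRootsOfUnity A ℂ
  obtain ⟨eB⟩ := CommGroup.monoidHom_mulEquiv_of_hasEnoughRootsOfUnity B ℂ
  have hf : Function.Injective f :=
    (injective_iff_map_eq_one f).2 fun a ha => hA a fun b => by rw [ha]; rfl
  have hg : Function.Injective f.flip :=
    (injective_iff_map_eq_one f.flip).2 fun b hb => hB b fun a => by
      rw [← MonoidHom.flip_apply, hb]; rfl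
  have hi : Function.Injective (eB.toMonoidHom.comp f) := eB.injective.comp hf
  have hj : Function.Injective (eA.toMonoidHom.comp f.flip) := eA.injective.comp hg
  have hcard : Nat.card A = Nat.card B :=
    le_antisymm (Nat.card_le_card_of_injective _ hi) (Nat.card_le_card_of_injective _ hj)
  exact ⟨MulEquiv.ofBijective (eB.toMonoidHom.comp f)
    ((Nat.bijective_iff_injective_and_card _).2 ⟨hi, hcard⟩)⟩

/-! ### Double duality -/

namespace ConformalModel

variable {P : Type*} [Fintype P] [DecidableEq P] {M : ConformalModel P}

/-- This is `mass_mul` at the vacuum, whose class is `g^⊥` and where `ρ_0(a) = d_a`. -/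
theorem mass_mul_mass_perp (g : M.FC) :
    M.mass (M.perp g : Set P) * M.mass (g : Set P) = 1 / (M.S M.vac M.vac).re ^ 2 := by
  classical
  rw [← mass_mul g M.vac]
  congr 1
  refine Finset.sum_congr (by ext; simp) fun a _ => ?_
  rw [rho_vac_left, Complex.norm_real, Real.norm_eq_abs, sq_abs]

theorem eq_of_subset_of_mass_eq {A B : Set P} (h : A ⊆ B) (hm : M.mass A = M.mass B) :
    A = B := by
  classical
  refine h.antisymm fun p hp => by_contra fun hn => hm.not_lt ?_
  refine Finset.sum_lt_sum_of_subset (i := p) (fun q hq => ?_) (by simpa using hp)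
    (by simpa using hn) (pow_pos (M.qdim_pos p) 2) fun q _ _ => sq_nonneg _
  exact Finset.mem_filter.2 ⟨Finset.mem_univ _, h (Finset.mem_filter.1 hq).2⟩

/-- `g` is contained in its double dual, and both have the same mass, since the product of the
masses of a set and its dual is constant. Quantum dimensions are positive, so nothing can be added.
-/
theorem perp_perp (g : M.FC) : M.perp (M.perp g : Set P) = g := by
  refine SetLike.coe_injective (eq_of_subset_of_mass_eq (M := M) (FC.subset_perp_perp (g : Set P)) ?_).symm
  have h1 := mass_mul_mass_perp g
  have h2 := mass_mul_mass_perp (M.perp g)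
  have h0 : 0 < 1 / (M.S M.vac M.vac).re ^ 2 := by
    have := (M.S_vac_pos M.vac).2
    positivity
  have h3 : M.mass (M.perp g : Set P) ≠ 0 := fun h => by
    rw [h, zero_mul] at h1
    exact h0.ne h1
  refine mul_left_cancel₀ h3 ?_
  rw [h1, ← h2, mul_comm]

/-- The double dual of `A` is contained in every element of the lattice that contains `A`. -/
theorem perp_perp_le {A : Set P} {g : M.FC} (h : A ⊆ g) : M.perp (M.perp A : Set P) ≤ g := by
  rw [← perp_perp g]
  have : M.perp g ≤ M.perp A := fun _ hq a ha => hq a (h ha)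
  exact FC.perp_anti this

/-! ### Maximal modulus and central extensions -/

theorem exists_rho_eq {p a : P} (h : ‖M.rho p a‖ = M.qdim a) :
    ∃ u : ℂ, ‖u‖ = 1 ∧ M.rho p a = M.qdim a * u := by
  have h0 := (M.qdim_pos a).ne'
  refine ⟨M.rho p a / M.qdim a, ?_, ?_⟩
  · rw [norm_div, h, Complex.norm_real, Real.norm_eq_abs, abs_of_pos (M.qdim_pos a), div_self h0]
  · have : (M.qdim a : ℂ) ≠ 0 := by exact_mod_cast h0
    field_simp

theorem norm_qdim_mul {u : ℂ} (hu : ‖u‖ = 1) (a : P) : ‖(M.qdim a : ℂ) * u‖ = M.qdim a := by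
  rw [norm_mul, hu, Complex.norm_real, Real.norm_eq_abs, abs_of_pos (M.qdim_pos a), mul_one]

theorem norm_rho_symm {p a : P} (h : ‖M.rho p a‖ = M.qdim a) : ‖M.rho a p‖ = M.qdim p := by
  obtain ⟨u, hu, h⟩ := exists_rho_eq h
  rw [M.rho_symm h, norm_qdim_mul hu]

/-- The primaries `a` for which `ρ_p(a)` has the largest possible modulus. -/
def centralizer (p : P) : M.FC where
  carrier := {a | ‖M.rho p a‖ = M.qdim a}
  vac_mem := by
    rw [Set.mem_ofPred_eq, M.rho_vac_right, norm_one, qdim, div_self (M.S_vac_pos _).2.ne']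
  -- Equality in the triangle inequality forces the phase `u * v` on every constituent of the fusion
  -- product.
  fusion_mem {a b c} ha hb hc := by
    obtain ⟨u, hu, ha⟩ := exists_rho_eq ha
    obtain ⟨v, hv, hb⟩ := exists_rho_eq hb
    rw [Set.mem_ofPred_eq, M.rho_fusion hu hv ha hb hc, norm_qdim_mul]
    rw [norm_mul, hu, hv, mul_one]

theorem mem_centralizer {p a : P} :
    a ∈ (centralizer p : M.FC) ↔ ‖M.rho p a‖ = M.qdim a := Iff.rfl

theorem Center.norm_rho_of_mem {g : M.FC} {z : M.Center g} {p a : P} (hp : p ∈ z.carrier)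
    (ha : a ∈ g) : ‖M.rho p a‖ = M.qdim a := by
  rw [Center.rho_eq hp ha, norm_qdim_mul (z.norm_char ha)]

/-- The extension is the double dual of the union of the central `h^⊥`-classes. By symmetry that
union is the intersection of the centralizers of the `a ∈ h^⊥`, so it is already in the lattice and
the double dual adds nothing. -/
theorem mem_cov_iff (h : M.FC) (p : P) :
    p ∈ h.cov ↔ ∀ a ∈ M.perp h, ‖M.rho p a‖ = M.qdim a := by
  constructor
  · intro hp a ha
    refine norm_rho_symm ((perp_perp_le (g := centralizer a) ?_ : h.cov ≤ _) hp)
    refine Set.iUnion₂_subset fun z _ q hq => ?_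
    exact norm_rho_symm (Center.norm_rho_of_mem hq ha)
  · intro hp
    exact FC.subset_perp_perp _ (Set.mem_biUnion (Subgroup.mem_top _) (Center.mem_ofRho p hp))

/-- The dual of `g/H` is the double dual of the union of the classes in `H`. For `a ∈ g` these
classes lie in `centralizer a`, hence so does the double dual. -/
theorem FC.le_cov_quot (g : M.FC) (H : Subgroup (M.Center g)) : g ≤ (g.quot H).cov := by
  intro a ha
  rw [mem_cov_iff]
  refine fun q hq => (perp_perp_le (g := centralizer a) ?_ : M.perp (g.quot H) ≤ _) hq
  refine Set.iUnion₂_subset fun z _ q hq => ?_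
  exact norm_rho_symm (Center.norm_rho_of_mem hq ha)

/-! ### The pairing between two centers -/

namespace Center

instance (g : M.FC) : Finite (M.Center g) :=
  inferInstanceAs (Finite {C : Set P // M.IsCentral g C})

variable {u v : M.FC}

/-- This makes the pairing independent of the chosen primaries and multiplicative in both arguments.
-/
theorem char_symm {z : M.Center u} {w : M.Center v} {a q : P} (ha : a ∈ z.carrier) (hav : a ∈ v)
    (hq : q ∈ w.carrier) (hqu : q ∈ u) : z.char q = w.char a := by
  have h0 : (M.qdim a : ℂ) ≠ 0 := by exact_mod_cast (M.qdim_pos a).ne'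
  exact mul_left_cancel₀ h0 ((M.rho_symm (rho_eq ha hqu)).symm.trans (rho_eq hq hav))

theorem char_ne_zero (z : M.Center u) {a : P} (ha : a ∈ u) : z.char a ≠ 0 := fun h => by
  have := z.norm_char ha
  rw [h] at this
  simp at this

/-- Subgroups of the centers of `u` and `v` whose classes meet `v`, respectively are contained
in `u`, are isomorphic if the pairing by the values of the central characters is nondegenerate. -/
theorem nonempty_mulEquiv (A : Subgroup (M.Center u)) (B : Subgroup (M.Center v))
    (hB : ∀ w ∈ B, w.carrier ⊆ u) (hA : ∀ z ∈ A, ∃ a ∈ z.carrier, a ∈ v)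
    (hu : ∀ q ∈ u, ∃ w ∈ B, q ∈ w.carrier)
    (hv : ∀ w ∈ B, (∀ z ∈ A, ∀ a ∈ z.carrier, a ∈ v → w.char a = 1) → w = 1) :
    Nonempty (A ≃* B) := by
  have hr : ∀ w : B, w.1.rep ∈ u := fun w => hB w w.2 w.1.rep_mem
  -- The pairing is the character of `z` at a representative of `w`. Multiplicativity in `z` is
  -- immediate; for `w` the value is rewritten as the character of `w` at some `a` in both `z` and
  -- `v`.
  let f : A →* B →* ℂˣ :=
    MonoidHom.mk' (fun z => MonoidHom.mk' (fun w => Units.mk0 _ (z.1.char_ne_zero (hr w)))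
      fun w w' => by
        obtain ⟨a, ha, hav⟩ := hA z z.2
        refine Units.ext ?_
        simp only [Units.val_mul, Units.val_mk0]
        rw [char_symm ha hav (rep_mem _) (hr _), char_symm ha hav (rep_mem _) (hr _),
          char_symm ha hav (rep_mem _) (hr _), Subgroup.coe_mul, char_mul _ _ hav])
      fun z z' => MonoidHom.ext fun w => Units.ext (char_mul z.1 z'.1 (hr w))
  have hf : ∀ z w, f z w = 1 → z.1.char w.1.rep = 1 := fun z w h => congrArg Units.val h
  refine nonempty_mulEquiv_of_nondegenerate_pairing f (fun z hz => Subtype.ext ?_)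
    (fun w hw => Subtype.ext ?_)
  · refine char_ext fun q hq => ?_
    obtain ⟨w, hw, hqw⟩ := hu q hq
    obtain ⟨a, ha, hav⟩ := hA z z.2
    rw [Subgroup.coe_one, char_one hq, char_symm ha hav hqw hq,
      ← char_symm ha hav w.rep_mem (hr ⟨w, hw⟩)]
    exact hf z ⟨w, hw⟩ (hz _)
  · refine hv w w.2 fun z hz a ha hav => ?_
    rw [← char_symm ha hav w.1.rep_mem (hr w)]
    exact hf ⟨z, hz⟩ w (hw _)

end Center

/-! ### The two isomorphisms -/

variable {g h k : M.FC}

/-- The part of `Z(h^⊥)` over the identity of `Z(g^⊥)` in terms of `k = g ∩ h^⊺`. -/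
theorem nonempty_ZR_perp_mulEquiv (hg : h ≤ g) (hk : k = g ⊓ h.cov) (hhk : h ≤ k) :
    Nonempty (M.ZR (M.perp h) (M.perp g) (FC.perp_anti hg) ≃* M.ZR k h hhk) := by
  subst hk
  refine Center.nonempty_mulEquiv _ _ (fun w hw => (mem_ZR_iff _ w).1 hw) (fun z hz => ?_)
    (fun q hq => ?_) (fun w _ H => Center.char_ext fun a ha => ?_)
  · have h1 := (mem_ZR_iff _ z).1 hz z.rep_mem
    rw [perp_perp g] at h1
    exact ⟨_, z.rep_mem, h1,
      (mem_cov_iff _ _).2 fun a ha => Center.norm_rho_of_mem z.rep_mem ha⟩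
  -- Every element of `h^⊺` has maximal modulus on `h^⊥`; by symmetry `q ∈ h^⊥` has it on `h^⊺`, so
  -- its class is central.
  · have hq' : ∀ a ∈ g ⊓ h.cov, ‖M.rho q a‖ = M.qdim a := fun a ha =>
      norm_rho_symm ((mem_cov_iff _ _).1 ha.2 q hq)
    refine ⟨Center.ofRho _ q hq', (mem_ZR_iff _ _).2 fun r hr a ha => ?_, Center.mem_ofRho q hq'⟩
    exact (hr a (hhk ha)).trans (hq a ha)
  · rw [Center.char_one ha]
    have ha' := (mem_cov_iff _ _).1 ha.2
    -- Each `a` in the meet lies in a central `h^⊥`-class, which stays inside `g^⊥⊥` because `a ∈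
    -- g`; this class serves as the test class.
    refine H (Center.ofRho _ a ha') ((mem_ZR_iff _ _).2 fun r hr b hb => ?_) a
      (Center.mem_ofRho a ha') ha
    rw [hr b (FC.perp_anti hg hb)]
    exact FC.subset_perp_perp (g : Set P) ha.1 b hb

/-- The image of `Z(h^⊥)` in `Z(g^⊥)` in terms of `k = h^⊺ ∨ g`. -/
theorem nonempty_IR_perp_mulEquiv (hg : h ≤ g) (hk : k = h.cov ⊔ g) (hgk : g ≤ k) :
    Nonempty (M.IR (M.perp h) (M.perp g) (FC.perp_anti hg) ≃* M.ZR k g hgk) := by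
  subst hk
  have hck : h.cov ≤ h.cov ⊔ g := le_sup_left
  have hcen : ∀ z : M.Center (M.perp h), ∀ p ∈ z.carrier, p ∈ h.cov := fun z p hp =>
    (mem_cov_iff _ _).2 fun a ha => Center.norm_rho_of_mem hp ha
  refine Center.nonempty_mulEquiv _ _ (fun w hw => (mem_ZR_iff _ w).1 hw) (fun z hz => ?_)
    (fun q hq => ?_) (fun w hw H => ?_)
  · obtain ⟨y, rfl⟩ := hz
    exact ⟨y.rep, subset_res _ y y.rep_mem, hck (hcen y _ y.rep_mem)⟩
  -- Since `centralizer q` is in the lattice, maximal modulus need only be checked on `h^⊺` and on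
  -- `g`.
  · have h1 : h.cov ⊔ g ≤ centralizer q := sup_le
      (fun a ha => norm_rho_symm ((mem_cov_iff _ _).1 ha q (FC.perp_anti hg hq)))
      (fun a ha => by rw [mem_centralizer, hq a ha]; exact Center.norm_rho_vac g a ha)
    have hq' : ∀ a ∈ h.cov ⊔ g, ‖M.rho q a‖ = M.qdim a := fun a ha => h1 ha
    refine ⟨Center.ofRho _ q hq', (mem_ZR_iff _ _).2 fun r hr a ha => ?_, Center.mem_ofRho q hq'⟩
    exact (hr a (hgk ha)).trans (hq a ha)
  -- The primaries on which the character of `w` could be detected are controlled by a dual, again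
  -- an element of the lattice: triviality on `h^⊺` comes from the pairing, on `g` from `w ⊆ g^⊥`.
  · have h1 : h.cov ⊔ g ≤ M.perp {w.rep} := by
      refine sup_le (fun a ha => ?_) (fun a ha => ?_)
      · have ha' := (mem_cov_iff _ _).1 ha
        have h2 := H _ ⟨Center.ofRho _ a ha', rfl⟩ a
          (subset_res _ _ (Center.mem_ofRho a ha')) (hck ha)
        have h3 := M.rho_symm (w.rho_rep a)
        rw [h2] at h3
        rintro _ rfl
        rw [h3, rho_vac_left, mul_one]
      · have h2 := (mem_ZR_iff _ w).1 hw w.rep_mem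
        rintro _ rfl
        exact FC.subset_perp_perp (g : Set P) ha _ h2
    refine Center.char_ext fun a ha => ?_
    have h2 := M.rho_symm (u := 1) (by rw [h1 ha w.rep rfl, rho_vac_left, mul_one])
    rw [w.rho_rep] at h2
    have h0 : (M.qdim a : ℂ) ≠ 0 := by exact_mod_cast (M.qdim_pos a).ne'
    rw [Center.char_one ha, mul_left_cancel₀ h0 h2]

end ConformalModel

theorem mainTheorem8 {P : Type*} [Fintype P] [DecidableEq P] (M : ConformalModel P)
    (g h : M.FC) (hg : h ≤ g) :
    Nonempty (M.ZR (M.perp h) (M.perp g) (ConformalModel.FC.perp_anti hg) ≃*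
      M.ZR (g ⊓ h.cov) h (le_inf hg h.le_cov)) ∧
    Nonempty (M.IR (M.perp h) (M.perp g) (ConformalModel.FC.perp_anti hg) ≃*
      M.ZR (h.cov ⊔ g) g le_sup_right) ∧
    ((∃ H : Subgroup (M.Center g), h = g.quot H) →
      Nonempty (M.ZR (M.perp h) (M.perp g) (ConformalModel.FC.perp_anti hg) ≃* M.ZR g h hg) ∧
      ∃ hc : g ≤ h.cov,
        Nonempty (M.IR (M.perp h) (M.perp g) (ConformalModel.FC.perp_anti hg) ≃*
          M.ZR h.cov g hc)) := by
  refine ⟨ConformalModel.nonempty_ZR_perp_mulEquiv hg rfl _,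
    ConformalModel.nonempty_IR_perp_mulEquiv hg rfl _, ?_⟩
  rintro ⟨H, rfl⟩
  have hc := g.le_cov_quot H
  -- As `g ⊆ h^⊺`, the meet is `g` and the join is `h^⊺`; having `k` given only through an equation
  -- avoids transporting the groups.
  exact ⟨ConformalModel.nonempty_ZR_perp_mulEquiv hg (inf_eq_left.2 hc).symm hg, hc,
    ConformalModel.nonempty_IR_perp_mulEquiv hg (sup_eq_left.2 hc).symm hc⟩
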